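/- Let $\delta\in(-1,1)$, $\alpha,\beta\in(0,1)$ and $\phi:\{0,1,2,\dots\}\to[0,1]$ with $\phi(n)=1-n^{-\beta}$ for all $n\ge 1$ (the value $\phi(0)\in[0,1]$ is arbitrary). On a probability space $(\Omega,\mathcal F,\mathbb P)$ let $\chi_0,\chi_1,\dots$ be independent $\{0,1\}$-valued random variables with $\mathbb P[\chi_n=1]=\phi(n)$, and let $\xi_0,\xi_1,\dots$ be i.i.d. $(0,1)$-valued random variables, the sequence $(\xi_n)$ being independent of the sequence $(\chi_n)$. Put $$p_n=\frac{1-\delta}{2}\,\chi_n+\xi_n(1-\chi_n)\in(0,1),\qquad \zeta_n=\log\frac{\xi_n}{1-\xi_n}.$$ Given the environment $\omega=(p_0,p_1,\dots)$, let $X=(X_t)_{t\ge 0}$ be, under the quenched law $\mathrm P_\omega$, the Markov chain on $\{0,1,2,\dots\}$ with $X_0=0$ that jumps from $n\ge 1$ to $n-1$ with probability $p_n$ and to $n+1$ with probability $1-p_n$, and that from $0$ stays at $0$ with probability $p_0$ and jumps to $1$ with probability $1-p_0$. Call $X$ recurrent for $\omega$ if $\mathrm P_\omega$-a.s. every state is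 visited infinitely often, and transient for $\omega$ if $\mathrm P_\omega$-a.s. every state is visited only finitely often. Suppose that the law of $\zeta_0$ is symmetric, i.e. $\mathbb P[\zeta_0\le -x]=\mathbb P[\zeta_0\ge x]$ for all $x\ge 0$, and that for some $c\in(0,\infty)$, $\mathbb P[\zeta_0>r]\sim c\,r^{-\alpha}$ as $r\to\infty$. (i) If $\beta<1-\alpha$, then (for any $\delta$) $X$ is recurrent for $\mathbb P$-a.e. $\omega$. (ii) If $\beta>1-\alpha$: if $\delta<0$, then $X$ is recurrent for $\mathbb P$-a.e. $\omega$; if $\delta>0$, then $X$ is transient for $\mathbb P$-a.e. $\omega$. -/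

import Mathlib

open MeasureTheory ProbabilityTheory Filter Asymptotics

/-- An environment: the probabilities `p n ∈ (0,1)` of a jump to the left from the site `n`. -/
abbrev Environment : Type := ℕ → Set.Ioo (0 : ℝ) 1

/-- The one-step law of the nearest-neighbour walk on `{0, 1, 2, …}` from the site `n`: from `n ≥ 1`
it goes to `n - 1` with probability `p n` and to `n + 1` with probability `1 - p n`; from `0` it
stays at `0` with probability `p 0` and goes to `1` with probability `1 - p 0`. -/
noncomputable def stepLaw (p : Environment) (n : ℕ) : Measure ℕ :=
  ENNReal.ofReal (p n : ℝ) • Measure.dirac (if n = 0 then 0 else n - 1) +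
    ENNReal.ofReal (1 - (p n : ℝ)) • Measure.dirac (n + 1)

/-- The transition kernel of the walk in the environment `p`. -/
noncomputable def stepKernel (p : Environment) : Kernel ℕ ℕ where
  toFun := stepLaw p
  measurable' := measurable_from_nat

instance instIsMarkovKernelStepKernel (p : Environment) : IsMarkovKernel (stepKernel p) where
  isProbabilityMeasure n := by
    constructor
    have h0 : (0 : ℝ) ≤ p n := (p n).2.1.le
    have h1 : (0 : ℝ) ≤ 1 - p n := sub_nonneg.2 (p n).2.2.le
    change stepLaw p n Set.univ = 1
    simp only [stepLaw, Measure.add_apply, Measure.smul_apply, measure_univ, smul_eq_mul, mul_one]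
    rw [← ENNReal.ofReal_add h0 h1]
    simp

/-- The transition mechanism as a function of the path up to time `t`: only the current position
matters. -/
noncomputable def pathKernel (p : Environment) (t : ℕ) : Kernel ((i : Finset.Iic t) → ℕ) ℕ :=
  (stepKernel p).comap (fun x => x ⟨t, Finset.mem_Iic.2 le_rfl⟩) (measurable_pi_apply _)

instance instIsMarkovKernelPathKernel (p : Environment) (t : ℕ) :
    IsMarkovKernel (pathKernel p t) := by
  unfold pathKernel; infer_instance

/-- The quenched law: the law on the path space of the Markov chain started at `0` with transition
kernel `stepKernel p`. The walk is the coordinate process on this space. -/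
noncomputable def quenchedLaw (p : Environment) : Measure (ℕ → ℕ) :=
  Kernel.trajMeasure (X := fun _ => ℕ) (Measure.dirac 0) (pathKernel p)

/-- The walk in the environment `p` is recurrent: almost surely under the quenched law, every state
is visited infinitely often. -/
def WalkRecurrent (p : Environment) : Prop :=
  ∀ n : ℕ, ∀ᵐ x ∂(quenchedLaw p), ∃ᶠ t in atTop, x t = n

/-- The walk in the environment `p` is transient: almost surely under the quenched law, every state
is visited only finitely often. -/
def WalkTransient (p : Environment) : Prop :=
  ∀ n : ℕ, ∀ᵐ x ∂(quenchedLaw p), ∀ᶠ t in atTop, x t ≠ n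

/-!
The walk is a birth-death chain. Its scale function `f n = ∑_{k < n} w k`, with
`w n = ∏_{1 ≤ k ≤ n} p k / (1 - p k)`, is harmonic off `0` and subharmonic at `0`, so martingale
convergence decides between recurrence and transience.

* If `∑ w k < ∞`, then `f (X t)` is a bounded submartingale and converges. By Lévy's conditional
  Borel–Cantelli lemma a state visited infinitely often has a right neighbour visited infinitely
  often, which contradicts convergence, since `f` is strictly increasing
  (`walkTransient_of_summable`).
* If `∑ w k = ∞`, then `f (X t)` killed at the first visit to `0` after time `s` is a nonnegative
  martingale and converges. Were there no such visit, the walk would reach arbitrarily large states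
  by the same Borel–Cantelli argument, and `f (X t)` would be unbounded
  (`walkRecurrent_of_tendsto`).

Here `w n = exp (S n)`, where `S` is the sum of the log-odds at the sites `1, …, n`. With
`v = log ((1 - δ) / (1 + δ))` and `V = 1 - χ`, the site `k` contributes `(ζ k - v) * V k + v`.

If `β < 1 - α`, then `∑ P(ζ k V k > L k) = ∞` for every `L > 0`, so the independent symmetric variables
`ζ k V k` exceed `L k` infinitely often. By Kolmogorov's zero-one law the partial sums of `ζ k V k`
minus `|v| n` are almost surely unbounded above or almost surely bounded above. In the second case
symmetry would bound the partial sums by a linear function on both sides, and hence also the single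
terms, which is impossible (`ae_frequently_mul_le_sum`). So `S n ≥ 0` infinitely often and
`∑ w k = ∞`.

If `β > 1 - α`, take a moment order `a < α` with `a + β > 1`. Then
`∑ E[((|v| + |ζ k|) V k / k) ^ a] < ∞`, so `∑ (|v| + |ζ k|) V k / k < ∞` almost surely, and Kronecker's
lemma gives `S n / n → v` (`ae_tendsto_average_thinned`). The sign of `v` is opposite to that of `δ`.
-/

namespace BirthDeath

open Preorder
open scoped Topology ENNReal

/-! ### The Markov property of the quenched walk -/

instance isProbabilityMeasure_quenchedLaw (p : Environment) :
    IsProbabilityMeasure (quenchedLaw p) := by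
  unfold quenchedLaw; infer_instance

theorem integral_stepKernel (p : Environment) (n : ℕ) (g : ℕ → ℝ) :
    ∫ y, g y ∂(stepKernel p n) = (p n : ℝ) * g (n - 1) + (1 - (p n : ℝ)) * g (n + 1) := by
  have h0 : (0 : ℝ) ≤ p n := (p n).2.1.le
  have h1 : (0 : ℝ) ≤ 1 - p n := sub_nonneg.2 (p n).2.2.le
  have hn : (if n = 0 then 0 else n - 1) = n - 1 := by split_ifs with h <;> simp [h]
  change ∫ y, g y ∂(stepLaw p n) = _
  rw [stepLaw, integral_add_measure, integral_smul_measure, integral_smul_measure, integral_dirac,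
    integral_dirac, hn, ENNReal.toReal_ofReal h0, ENNReal.toReal_ofReal h1, smul_eq_mul,
    smul_eq_mul]
  · exact (integrable_dirac (by simp)).smul_measure ENNReal.ofReal_ne_top
  · exact (integrable_dirac (by simp)).smul_measure ENNReal.ofReal_ne_top

/-- The Markov property of the walk, for a function of the next position. -/
theorem condExp_next (p : Environment) (t : ℕ) (g : ℕ → ℝ)
    (hg : Integrable (fun x : ℕ → ℕ => g (x (t + 1))) (quenchedLaw p)) :
    (quenchedLaw p)[fun x : ℕ → ℕ => g (x (t + 1)) | Filtration.piLE (X := fun _ => ℕ) t]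
      =ᵐ[quenchedLaw p]
      fun x => (p (x t) : ℝ) * g (x t - 1) + (1 - (p (x t) : ℝ)) * g (x t + 1) := by
  rw [Filtration.piLE_eq_comap_frestrictLe]
  have h1 := condExp_ae_eq_integral_condDistrib (μ := quenchedLaw p)
    (X := frestrictLe (π := fun _ => ℕ) t) (Y := fun x : ℕ → ℕ => x (t + 1))
    (measurable_frestrictLe (X := fun _ => ℕ) t) (measurable_pi_apply _).aemeasurable (f := g)
    (measurable_of_countable g).stronglyMeasurable
    hg
  have h2 := ae_of_ae_map (measurable_frestrictLe t).aemeasurable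
    (Kernel.condDistrib_trajMeasure (X := fun _ => ℕ) (μ₀ := Measure.dirac 0)
      (κ := pathKernel p) (a := t))
  filter_upwards [h1, h2] with x hx1 hx2
  rw [hx1]
  erw [hx2]
  exact integral_stepKernel p (x t) g

theorem ae_start (p : Environment) : ∀ᵐ x ∂(quenchedLaw p), x 0 = 0 := by
  have h : (quenchedLaw p).map (frestrictLe (π := fun _ => ℕ) 0) =
      (Measure.dirac 0).map (MeasurableEquiv.piUnique (fun _ : Finset.Iic 0 => ℕ)).symm := by
    unfold quenchedLaw Kernel.trajMeasure
    rw [Measure.map_comp _ _ (by fun_prop), Kernel.traj_map_frestrictLe, Kernel.partialTraj_self,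
      Measure.id_comp]
  rw [Measure.map_dirac] at h
  have h2 : ∀ᵐ y ∂((quenchedLaw p).map (frestrictLe (π := fun _ => ℕ) 0)),
      y ⟨0, by simp⟩ = 0 := by
    rw [h, ae_dirac_iff]
    · rfl
    · exact measurable_pi_apply _ (measurableSet_singleton 0)
  exact ae_of_ae_map (measurable_frestrictLe 0).aemeasurable h2

theorem measurable_coord (t : ℕ) :
    Measurable[Filtration.piLE (X := fun _ => ℕ) t] (fun x : ℕ → ℕ => x t) := by
  rw [Filtration.piLE_eq_comap_frestrictLe]
  exact (measurable_pi_apply (⟨t, by simp⟩ : Finset.Iic t)).comp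
    (comap_measurable (frestrictLe (π := fun _ => ℕ) t))

theorem ae_le_time (p : Environment) (t : ℕ) : ∀ᵐ x ∂(quenchedLaw p), x t ≤ t := by
  induction t with
  | zero => filter_upwards [ae_start p] with x hx using hx.le
  | succ t ih =>
    set g : ℕ → ℝ := fun n => if t + 1 < n then 1 else 0 with hg
    have hgm : Measurable (fun x : ℕ → ℕ => g (x (t + 1))) :=
      (measurable_of_countable g).comp (measurable_pi_apply _)
    have hg0 : ∀ n, 0 ≤ g n := fun n => by simp only [hg]; split_ifs <;> norm_num
    have hint : Integrable (fun x : ℕ → ℕ => g (x (t + 1))) (quenchedLaw p) := by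
      refine Integrable.of_bound hgm.aestronglyMeasurable 1 (Eventually.of_forall fun x => ?_)
      rw [Real.norm_of_nonneg (hg0 _)]
      simp only [hg]; split_ifs <;> norm_num
    have hz : ∫ x, g (x (t + 1)) ∂(quenchedLaw p) = 0 := by
      rw [← integral_condExp ((Filtration.piLE (X := fun _ => ℕ)).le t)]
      refine integral_eq_zero_of_ae ?_
      filter_upwards [condExp_next p t g hint, ih] with x hx hxt
      rw [hx]
      have h1 : g (x t - 1) = 0 := if_neg (by omega)
      have h2 : g (x t + 1) = 0 := if_neg (by omega)
      simp [h1, h2]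
    rw [integral_eq_zero_iff_of_nonneg (fun x => hg0 _) hint] at hz
    filter_upwards [hz] with x hx
    by_contra hlt
    have : g (x (t + 1)) = 1 := if_pos (by omega)
    simp only [Pi.zero_apply] at hx
    linarith

/-- The walk up to time `t` stays in a finite set, so that every function of it is integrable. -/
theorem integrable_coord (p : Environment) (t : ℕ) (g : ℕ → ℝ) :
    Integrable (fun x : ℕ → ℕ => g (x t)) (quenchedLaw p) := by
  refine Integrable.of_bound
    ((measurable_of_countable g).comp (measurable_pi_apply t)).aestronglyMeasurable
    (∑ n ∈ Finset.range (t + 1), ‖g n‖) ?_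
  filter_upwards [ae_le_time p t] with x hx
  exact Finset.single_le_sum (f := fun n => ‖g n‖) (fun _ _ => norm_nonneg _)
    (Finset.mem_range.2 (Nat.lt_succ_of_le hx))

/-! ### Infinitely many visits -/

/-- Almost surely, if a state is visited infinitely often, so is its right neighbour: each visit
offers the same positive chance of a jump to the right, so Lévy's conditional Borel–Cantelli lemma
applies. -/
theorem ae_frequently_succ (p : Environment) (n : ℕ) :
    ∀ᵐ x ∂(quenchedLaw p), (∃ᶠ t in atTop, x t = n) → ∃ᶠ t in atTop, x t = n + 1 := by
  set s : ℕ → Set (ℕ → ℕ) := fun t => {x | x t = n + 1} with hs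
  have hsm : ∀ t, MeasurableSet[Filtration.piLE (X := fun _ => ℕ) t] (s t) := fun t =>
    measurable_coord t (measurableSet_singleton (n + 1))
  set g : ℕ → ℝ := fun m => if m = n + 1 then 1 else 0 with hg
  have hg0 : ∀ m, 0 ≤ g m := fun m => by simp only [hg]; split_ifs <;> norm_num
  have hsg : ∀ t, (s (t + 1)).indicator (1 : (ℕ → ℕ) → ℝ) = fun x => g (x (t + 1)) := by
    intro t; ext x
    simp [hs, hg, Set.indicator_apply]
  have hc : ∀ᵐ x ∂(quenchedLaw p), ∀ t,
      ((quenchedLaw p)[(s (t + 1)).indicator (1 : (ℕ → ℕ) → ℝ) |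
        Filtration.piLE (X := fun _ => ℕ) t]) x =
      (p (x t) : ℝ) * g (x t - 1) + (1 - (p (x t) : ℝ)) * g (x t + 1) := by
    refine ae_all_iff.2 fun t => ?_
    rw [hsg]
    exact condExp_next p t g (integrable_coord p (t + 1) g)
  filter_upwards [ae_mem_limsup_atTop_iff (quenchedLaw p) hsm, hc] with x hx hcx hfreq
  have hgoal : x ∈ limsup s atTop := by
    rw [hx]
    simp_rw [hcx]
    have hnn : ∀ t, 0 ≤ (p (x t) : ℝ) * g (x t - 1) + (1 - (p (x t) : ℝ)) * g (x t + 1) :=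
      fun t => add_nonneg (mul_nonneg (p (x t)).2.1.le (hg0 _))
        (mul_nonneg (sub_nonneg.2 (p (x t)).2.2.le) (hg0 _))
    refine (not_summable_iff_tendsto_nat_atTop_of_nonneg hnn).1 fun hsum => ?_
    have hpos : (0 : ℝ) < 1 - p n := sub_pos.2 (p n).2.2
    obtain ⟨t, ht, htn⟩ := (hfreq.and_eventually
      (hsum.tendsto_atTop_zero.eventually (gt_mem_nhds hpos))).exists
    rw [ht] at htn
    have h1 : g (n + 1) = 1 := if_pos rfl
    rw [h1] at htn
    linarith [mul_nonneg (p n).2.1.le (hg0 (n - 1))]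
  rw [mem_limsup_iff_frequently_mem] at hgoal
  exact hgoal

theorem ae_frequently_of_le (p : Environment) :
    ∀ᵐ x ∂(quenchedLaw p), ∀ n m, n ≤ m → (∃ᶠ t in atTop, x t = n) → ∃ᶠ t in atTop, x t = m := by
  filter_upwards [ae_all_iff.2 (ae_frequently_succ p)] with x hx n m hnm h
  induction m, hnm using Nat.le_induction with
  | base => exact h
  | succ k _ ih => exact hx k ih

/-! ### The scale function -/

/-- The product `∏_{1 ≤ k ≤ n} p k / (1 - p k)`, which is the increment of the scale function from
`n` to `n + 1`. The value `p 0` does not enter, and the factors are indexed from `0`. -/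
noncomputable def weight (p : Environment) (n : ℕ) : ℝ :=
  ∏ k ∈ Finset.range n, ((p (k + 1) : ℝ) / (1 - (p (k + 1) : ℝ)))

/-- The scale function of the walk: it is harmonic at every state `n ≥ 1` and vanishes at `0`. -/
noncomputable def scale (p : Environment) (n : ℕ) : ℝ :=
  ∑ k ∈ Finset.range n, weight p k

theorem weight_pos (p : Environment) (n : ℕ) : 0 < weight p n :=
  Finset.prod_pos fun k _ => div_pos (p (k + 1)).2.1 (sub_pos.2 (p (k + 1)).2.2)

theorem scale_zero (p : Environment) : scale p 0 = 0 := by simp [scale]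

theorem scale_succ (p : Environment) (n : ℕ) : scale p (n + 1) = scale p n + weight p n := by
  simp [scale, Finset.sum_range_succ]

theorem scale_nonneg (p : Environment) (n : ℕ) : 0 ≤ scale p n :=
  Finset.sum_nonneg fun k _ => (weight_pos p k).le

theorem scale_harmonic (p : Environment) {n : ℕ} (hn : n ≠ 0) :
    (p n : ℝ) * scale p (n - 1) + (1 - (p n : ℝ)) * scale p (n + 1) = scale p n := by
  obtain ⟨m, rfl⟩ := Nat.exists_eq_succ_of_ne_zero hn
  have h : (1 - (p (m + 1) : ℝ)) ≠ 0 := (sub_pos.2 (p (m + 1)).2.2).ne'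
  have hw : weight p (m + 1) * (1 - (p (m + 1) : ℝ)) = weight p m * p (m + 1) := by
    rw [weight, Finset.prod_range_succ, ← weight]
    field_simp
  simp only [Nat.succ_eq_add_one, Nat.add_sub_cancel, scale_succ]
  linear_combination hw

theorem scale_subharmonic (p : Environment) (n : ℕ) :
    scale p n ≤ (p n : ℝ) * scale p (n - 1) + (1 - (p n : ℝ)) * scale p (n + 1) := by
  rcases eq_or_ne n 0 with rfl | hn
  · refine (scale_zero p).le.trans ?_
    exact add_nonneg (mul_nonneg (p 0).2.1.le (scale_nonneg p _))
      (mul_nonneg (sub_nonneg.2 (p 0).2.2.le) (scale_nonneg p _))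
  · exact (scale_harmonic p hn).ge

/-! ### Transience -/

/-- If the scale function is bounded, it is a bounded submartingale along the walk, hence converges.
As it takes different values at neighbouring states, no state can be visited infinitely often. -/
theorem walkTransient_of_summable (p : Environment) (h : Summable (weight p)) :
    WalkTransient p := by
  have hle : ∀ n, scale p n ≤ ∑' k, weight p k := fun n =>
    h.sum_le_tsum _ fun k _ => (weight_pos p k).le
  have hsub : Submartingale (fun t (x : ℕ → ℕ) => scale p (x t))
      (Filtration.piLE (X := fun _ => ℕ)) (quenchedLaw p) := by
    refine submartingale_nat
      (fun t => ((measurable_of_countable (scale p)).comp (measurable_coord t)).stronglyMeasurable)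
      (fun t => integrable_coord p t _) fun t => ?_
    filter_upwards [condExp_next p t (scale p) (integrable_coord p (t + 1) _)] with x hx
    rw [hx]
    exact scale_subharmonic p (x t)
  have hconv := hsub.exists_ae_tendsto_of_bdd (R := (∑' k, weight p k).toNNReal) fun t => by
    refine (eLpNorm_le_of_ae_bound (C := ∑' k, weight p k) (Eventually.of_forall fun x => ?_)).trans
      ?_
    · rw [Real.norm_of_nonneg (scale_nonneg p _)]; exact hle _
    · simp [ENNReal.ofReal]
  intro n
  filter_upwards [hconv, ae_frequently_succ p n] with x ⟨c, hc⟩ hx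
  by_contra hcon
  have h1 : ∃ᶠ t in atTop, x t = n := by simpa [Filter.Frequently] using hcon
  have key : ∀ m, (∃ᶠ t in atTop, x t = m) → c = scale p m := fun m hm =>
    tendsto_nhds_unique_of_frequently_eq hc tendsto_const_nhds (hm.mono fun t ht => by rw [ht])
  have h2 := scale_succ p n
  rw [← key n h1, ← key (n + 1) (hx h1)] at h2
  linarith [weight_pos p n]

/-! ### Recurrence -/

/-- The event that the walk does not visit `0` at the times `s, …, s + t`. -/
def avoid (s t : ℕ) : Set (ℕ → ℕ) := {x | ∀ i ≤ t, x (s + i) ≠ 0}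

/-- The filtration generated by the walk, with time shifted by `s`. -/
def shiftedFiltration (s : ℕ) : Filtration ℕ (MeasurableSpace.pi : MeasurableSpace (ℕ → ℕ)) where
  seq t := Filtration.piLE (X := fun _ => ℕ) (s + t)
  mono' _ _ h := (Filtration.piLE (X := fun _ => ℕ)).mono (by omega)
  le' _ := (Filtration.piLE (X := fun _ => ℕ)).le _

theorem measurableSet_avoid (s t : ℕ) : MeasurableSet[shiftedFiltration s t] (avoid s t) := by
  have : avoid s t = ⋂ i ∈ Finset.range (t + 1), {x : ℕ → ℕ | x (s + i) = 0}ᶜ := by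
    ext x; simp [avoid]
  rw [this]
  refine Finset.measurableSet_biInter _ fun i hi => MeasurableSet.compl ?_
  refine (Filtration.piLE (X := fun _ => ℕ)).mono
    (show s + i ≤ s + t by have := Finset.mem_range.1 hi; omega) _ ?_
  exact measurable_coord (s + i) (measurableSet_singleton 0)

/-- The scale function along the walk after time `s`, killed at the first visit to `0`, is a
martingale. -/
theorem martingale_scale_avoid (p : Environment) (s : ℕ) :
    Martingale (fun t => (avoid s t).indicator fun x : ℕ → ℕ => scale p (x (s + t)))
      (shiftedFiltration s) (quenchedLaw p) := by
  have hle : ∀ t, shiftedFiltration s t ≤ (MeasurableSpace.pi : MeasurableSpace (ℕ → ℕ)) :=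
    (shiftedFiltration s).le
  refine martingale_nat (fun t => ?_) (fun t => ?_) fun t => ?_
  · exact (((measurable_of_countable (scale p)).comp (measurable_coord (s + t))).indicator
      (measurableSet_avoid s t)).stronglyMeasurable
  · exact (integrable_coord p (s + t) _).indicator (hle t _ (measurableSet_avoid s t))
  · have heq : ((avoid s (t + 1)).indicator fun x : ℕ → ℕ => scale p (x (s + (t + 1)))) =
        (avoid s t).indicator fun x : ℕ → ℕ => scale p (x (s + t + 1)) := by
      ext x
      by_cases h1 : x ∈ avoid s (t + 1)
      · rw [Set.indicator_of_mem h1,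
          Set.indicator_of_mem (show x ∈ avoid s t from fun i hi => h1 i (by omega)), add_assoc]
      · rw [Set.indicator_of_notMem h1]
        by_cases h2 : x ∈ avoid s t
        · rw [Set.indicator_of_mem h2]
          have h0 : x (s + t + 1) = 0 := by
            by_contra hne
            refine h1 fun i hi => ?_
            rcases Nat.lt_or_ge t i with hlt | hge
            · obtain rfl : i = t + 1 := by omega
              exact hne
            · exact h2 i hge
          rw [h0, scale_zero]
        · rw [Set.indicator_of_notMem h2]
    rw [heq]
    have hint := integrable_coord p (s + t + 1) (scale p)
    filter_upwards [condExp_indicator (m := shiftedFiltration s t) hint (measurableSet_avoid s t),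
      condExp_next p (s + t) (scale p) hint] with x hx1 hx2
    rw [hx1]
    by_cases hx : x ∈ avoid s t
    · rw [Set.indicator_of_mem hx, Set.indicator_of_mem hx]
      exact ((hx2.trans (scale_harmonic p (hx t le_rfl)))).symm
    · rw [Set.indicator_of_notMem hx, Set.indicator_of_notMem hx]

/-- If the scale function is unbounded, the walk returns to `0` after every time `s`: otherwise the
scale function along the walk would converge, while the walk would visit arbitrarily large
states. -/
theorem ae_exists_visit_zero (p : Environment) (h : Tendsto (scale p) atTop atTop) (s : ℕ) :
    ∀ᵐ x ∂(quenchedLaw p), ∃ t, s ≤ t ∧ x t = 0 := by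
  have hM := martingale_scale_avoid p s
  have hnn : ∀ t x, 0 ≤ (avoid s t).indicator (fun x : ℕ → ℕ => scale p (x (s + t))) x :=
    fun t x => Set.indicator_nonneg (fun _ _ => scale_nonneg p _) x
  have hconv := hM.submartingale.exists_ae_tendsto_of_bdd
    (R := (∫ x, (avoid s 0).indicator (fun x : ℕ → ℕ => scale p (x (s + 0))) x
      ∂(quenchedLaw p)).toNNReal) fun t => by
    rw [eLpNorm_one_eq_lintegral_enorm]
    simp_rw [Real.enorm_eq_ofReal (hnn t _)]
    rw [← ofReal_integral_eq_lintegral_ofReal (hM.integrable t) (Eventually.of_forall (hnn t))]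
    have := hM.setIntegral_eq (Nat.zero_le t) (s := Set.univ) MeasurableSet.univ
    simp only [setIntegral_univ] at this
    rw [← this]
    rfl
  filter_upwards [hconv, ae_frequently_of_le p] with x ⟨c, hc⟩ hx
  by_contra hcon
  push Not at hcon
  have hav : ∀ t, x ∈ avoid s t := fun t i _ => hcon (s + i) (by omega)
  simp_rw [Set.indicator_of_mem (hav _)] at hc
  obtain ⟨N, hN⟩ := ((h.eventually_gt_atTop (c + 1)).exists_forall_of_atTop)
  have hev : ∀ᶠ t in atTop, x (s + t) < N := by
    filter_upwards [hc.eventually (gt_mem_nhds (lt_add_one c))] with t ht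
    by_contra hge
    exact absurd (hN _ (not_lt.1 hge)) (not_lt.2 ht.le)
  have hev' : ∀ᶠ t in atTop, x t < N := by
    obtain ⟨T, hT⟩ := hev.exists_forall_of_atTop
    filter_upwards [eventually_ge_atTop (s + T)] with t ht
    have := hT (t - s) (by omega)
    rwa [Nat.add_sub_cancel' (by omega)] at this
  have hex : ∃ n ∈ Finset.range N, ∃ᶠ t in atTop, x t = n := by
    by_contra hno
    push Not at hno
    have := (Filter.eventually_all_finset (Finset.range N)).2 hno
    obtain ⟨t, h1, h2⟩ := (this.and hev').exists
    exact h1 (x t) (Finset.mem_range.2 h2) rfl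
  obtain ⟨n, hn, hfreq⟩ := hex
  obtain ⟨t, h1, h2⟩ := ((hx n N (Finset.mem_range.1 hn).le hfreq).and_eventually hev').exists
  omega

theorem walkRecurrent_of_tendsto (p : Environment) (h : Tendsto (scale p) atTop atTop) :
    WalkRecurrent p := by
  intro n
  filter_upwards [ae_all_iff.2 (ae_exists_visit_zero p h), ae_frequently_of_le p] with x hx1 hx2
  exact hx2 0 n (Nat.zero_le n) (frequently_atTop.2 hx1)

theorem walkRecurrent_of_frequently (p : Environment) (h : ∃ᶠ n in atTop, 1 ≤ weight p n) :
    WalkRecurrent p := by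
  refine walkRecurrent_of_tendsto p
    ((not_summable_iff_tendsto_nat_atTop_of_nonneg fun n => (weight_pos p n).le).1 fun hsum => ?_)
  obtain ⟨n, h1, h2⟩ := (h.and_eventually
    (hsum.tendsto_atTop_zero.eventually (gt_mem_nhds one_pos))).exists
  linarith

/-! ### Partial sums of symmetric random variables -/

section SymmetricSums

variable {Ω : Type*} {mΩ : MeasurableSpace Ω} {μ : Measure Ω}

theorem measurableSet_frequently_le {m : MeasurableSpace Ω} {u : ℕ → Ω → ℝ} {N : ℕ}
    (hu : ∀ n, N ≤ n → Measurable[m] (u n)) :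
    MeasurableSet[m] {ω | ∀ C : ℕ, ∃ᶠ n in atTop, (C : ℝ) ≤ u n ω} := by
  have : {ω | ∀ C : ℕ, ∃ᶠ n in atTop, (C : ℝ) ≤ u n ω} =
      ⋂ C : ℕ, ⋂ a : ℕ, ⋃ n ∈ {n | max a N ≤ n}, {ω | (C : ℝ) ≤ u n ω} := by
    ext ω
    simp only [Set.mem_ofPred_eq, Set.mem_iInter, Set.mem_iUnion, exists_prop]
    refine forall_congr' fun C => ⟨fun h a => ?_, fun h => frequently_atTop.2 fun a => ?_⟩
    · exact frequently_atTop.1 h (max a N)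
    · obtain ⟨n, hn, hC⟩ := h a
      exact ⟨n, (le_max_left _ _).trans hn, hC⟩
  rw [this]
  exact MeasurableSet.iInter fun C => MeasurableSet.iInter fun a =>
    MeasurableSet.biUnion (Set.to_countable _) fun n hn =>
      hu n ((le_max_right _ _).trans hn) measurableSet_Ici

/-- Kolmogorov's zero-one law for the event that the partial sums, with a linear drift subtracted,
are unbounded above. -/
theorem measure_unbounded_zero_or_one {Y : ℕ → Ω → ℝ} (hY : ∀ k, Measurable (Y k))
    (hindep : iIndepFun Y μ) (K : ℝ) :
    μ {ω | ∀ C : ℕ, ∃ᶠ n in atTop, (C : ℝ) ≤ ∑ k ∈ Finset.range n, Y k ω - K * n} = 0 ∨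
    μ {ω | ∀ C : ℕ, ∃ᶠ n in atTop, (C : ℝ) ≤ ∑ k ∈ Finset.range n, Y k ω - K * n} = 1 := by
  refine measure_zero_or_one_of_measurableSet_limsup_atTop
    (s := fun k => MeasurableSpace.comap (Y k) inferInstance) (fun k => (hY k).comap_le) hindep ?_
  rw [limsup_eq_iInf_iSup_of_nat, MeasurableSpace.measurableSet_iInf]
  intro N
  -- the first `N` terms only change the partial sums by a constant
  have hset : {ω | ∀ C : ℕ, ∃ᶠ n in atTop, (C : ℝ) ≤ ∑ k ∈ Finset.range n, Y k ω - K * n} =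
      {ω | ∀ C : ℕ, ∃ᶠ n in atTop, (C : ℝ) ≤ ∑ k ∈ Finset.Ico N n, Y k ω - K * n} := by
    ext ω
    have hsplit : ∀ n, N ≤ n → ∑ k ∈ Finset.range n, Y k ω =
        ∑ k ∈ Finset.range N, Y k ω + ∑ k ∈ Finset.Ico N n, Y k ω := fun n hn =>
      (Finset.sum_range_add_sum_Ico _ hn).symm
    constructor
    · intro h C
      obtain ⟨D, hD⟩ := exists_nat_ge (C + ∑ k ∈ Finset.range N, Y k ω)
      refine ((h D).and_eventually (eventually_ge_atTop N)).mono fun n hn => ?_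
      have := hsplit n hn.2
      linarith [hn.1]
    · intro h C
      obtain ⟨D, hD⟩ := exists_nat_ge (C - ∑ k ∈ Finset.range N, Y k ω)
      refine ((h D).and_eventually (eventually_ge_atTop N)).mono fun n hn => ?_
      have := hsplit n hn.2
      linarith [hn.1]
  rw [hset]
  refine measurableSet_frequently_le (N := 0) fun n _ => Measurable.sub_const ?_ _
  refine Finset.measurable_sum _ fun k hk => ?_
  have hk' : N ≤ k := (Finset.mem_Ico.1 hk).1
  exact (comap_measurable (Y k)).mono
    (le_iSup₂ (f := fun i (_ : i ≥ N) => MeasurableSpace.comap (Y i) inferInstance) k hk') le_rfl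

/-- Partial sums of independent symmetric random variables of which infinitely many exceed a large
linear function exceed a linear function infinitely often. Otherwise, by the zero-one law and by
symmetry, the partial sums would be bounded by a linear function on both sides, and so would be
their increments. -/
theorem ae_frequently_mul_le_sum [IsProbabilityMeasure μ] {Y : ℕ → Ω → ℝ}
    (hY : ∀ k, Measurable (Y k)) (hindep : iIndepFun Y μ)
    (hsymm : ∀ k, μ.map (Y k) = μ.map fun ω => -Y k ω) (K : ℝ)
    (hbig : ∀ᵐ ω ∂μ, ∃ᶠ k : ℕ in atTop, (2 * K + 1) * k < Y k ω) :
    ∀ᵐ ω ∂μ, ∃ᶠ n : ℕ in atTop, K * n ≤ ∑ k ∈ Finset.range n, Y k ω := by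
  set B : Set (ℕ → ℝ) :=
    {y | ∀ C : ℕ, ∃ᶠ n in atTop, (C : ℝ) ≤ ∑ k ∈ Finset.range n, y k - K * n} with hB
  have hBm : MeasurableSet B := measurableSet_frequently_le (N := 0) fun n _ => by fun_prop
  have hlaw : μ.map (fun ω k => Y k ω) = μ.map (fun ω k => -Y k ω) := by
    have h2 : iIndepFun (fun k ω => -Y k ω) μ :=
      hindep.comp (fun _ y => -y) fun _ => measurable_neg
    rw [hindep.map_fun_eq_infinitePi_map hY, h2.map_fun_eq_infinitePi_map fun k => (hY k).fun_neg]
    congr 1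
    exact funext hsymm
  rcases measure_unbounded_zero_or_one hY hindep K with h0 | h1
  · exfalso
    have hneg : μ {ω | (fun k => -Y k ω) ∈ B} = 0 := by
      have e1 := Measure.map_apply (μ := μ) (f := fun ω k => Y k ω) (by fun_prop) hBm
      have e2 := Measure.map_apply (μ := μ) (f := fun ω k => -Y k ω) (by fun_prop) hBm
      rw [← hlaw, e1] at e2
      exact e2.symm.trans h0
    have hn0 : ∀ᵐ ω ∂μ, ω ∉ {ω | (fun k => Y k ω) ∈ B} := measure_eq_zero_iff_ae_notMem.1 h0
    have hn1 : ∀ᵐ ω ∂μ, ω ∉ {ω | (fun k => -Y k ω) ∈ B} := measure_eq_zero_iff_ae_notMem.1 hneg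
    obtain ⟨ω, hω0, hω1, hω⟩ := (hn0.and (hn1.and hbig)).exists
    simp only [hB, Set.mem_ofPred_eq, not_forall, not_frequently, not_le] at hω0 hω1
    obtain ⟨C, hC⟩ := hω0
    obtain ⟨D, hD⟩ := hω1
    obtain ⟨E, hE⟩ := exists_nat_ge (C + D + K)
    obtain ⟨k, h1, h2, h3, h4⟩ := (hω.and_eventually
      (((tendsto_add_atTop_nat 1).eventually hC).and (hD.and (eventually_ge_atTop E)))).exists
    rw [Finset.sum_range_succ] at h2
    rw [Finset.sum_neg_distrib] at h3
    have h5 : (E : ℝ) ≤ k := by exact_mod_cast h4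
    push_cast at h2
    linarith
  · have hev : ∀ᵐ ω ∂μ,
        ∀ C : ℕ, ∃ᶠ n in atTop, (C : ℝ) ≤ ∑ k ∈ Finset.range n, Y k ω - K * n :=
      (mem_ae_iff_prob_eq_one (measurableSet_frequently_le (N := 0) fun n _ => by fun_prop)).2 h1
    filter_upwards [hev] with ω hω
    refine (hω 0).mono fun n hn => ?_
    push_cast at hn
    linarith

end SymmetricSums

/-! ### Independence and symmetry of thinned variables -/

section Independence

variable {Ω : Type*} {mΩ : MeasurableSpace Ω} {μ : Measure Ω}

/-- Two independent sequences of independent random variables combine to a sequence of independent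
pairs. -/
theorem iIndepFun_prodMk_of_indepFun {ι α β : Type*} [MeasurableSpace α] [MeasurableSpace β]
    {f : ι → Ω → α} {g : ι → Ω → β} (hf : ∀ i, Measurable (f i)) (hg : ∀ i, Measurable (g i))
    (hfi : iIndepFun f μ) (hgi : iIndepFun g μ)
    (hfg : IndepFun (fun ω i => f i ω) (fun ω i => g i ω) μ) :
    iIndepFun (fun i ω => (f i ω, g i ω)) μ := by
  set R : Set (Set (α × β)) :=
    Set.image2 (· ×ˢ ·) {s : Set α | MeasurableSet s} {t : Set β | MeasurableSet t} with hR
  refine iIndepSets.iIndep (π := fun i => (fun s => (fun ω => (f i ω, g i ω)) ⁻¹' s) '' R) ?_ ?_ ?_ ?_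
  · exact fun i => ((hf i).prodMk (hg i)).comap_le
  · exact fun i => isPiSystem_prod.comap _
  · intro i
    rw [← generateFrom_prod, MeasurableSpace.comap_generateFrom]
  · rw [iIndepSets_iff]
    intro S u hu
    choose! v hv huv using hu
    have hv' : ∀ i ∈ S, ∃ a : Set α, ∃ b : Set β, MeasurableSet a ∧ MeasurableSet b ∧ v i = a ×ˢ b :=
      fun i hi => by
        obtain ⟨a, ha, b, hb, hab⟩ := hv i hi
        exact ⟨a, b, ha, hb, hab.symm⟩
    choose! a b ha hb hab using hv'
    have hu' : ∀ i ∈ S, u i = f i ⁻¹' a i ∩ g i ⁻¹' b i := fun i hi => by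
      rw [← huv i hi, hab i hi]; rfl
    have hA : MeasurableSet ((S : Set ι).pi a) := MeasurableSet.pi S.countable_toSet ha
    have hB : MeasurableSet ((S : Set ι).pi b) := MeasurableSet.pi S.countable_toSet hb
    have hInter : ⋂ i ∈ S, u i =
        (fun ω i => f i ω) ⁻¹' (S : Set ι).pi a ∩ (fun ω i => g i ω) ⁻¹' (S : Set ι).pi b := by
      rw [Set.iInter₂_congr hu']
      ext ω
      simp only [Set.mem_iInter, Set.mem_inter_iff, Set.mem_preimage, Set.mem_pi, Finset.mem_coe]
      exact ⟨fun h => ⟨fun i hi => (h i hi).1, fun i hi => (h i hi).2⟩,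
        fun h i hi => ⟨h.1 i hi, h.2 i hi⟩⟩
    have hfA : (fun ω i => f i ω) ⁻¹' (S : Set ι).pi a = ⋂ i ∈ S, f i ⁻¹' a i := by
      ext ω; simp
    have hgB : (fun ω i => g i ω) ⁻¹' (S : Set ι).pi b = ⋂ i ∈ S, g i ⁻¹' b i := by
      ext ω; simp
    rw [hInter, hfg.measure_inter_preimage_eq_mul _ _ hA hB, hfA, hgB,
      hfi.measure_inter_preimage_eq_mul S ha, hgi.measure_inter_preimage_eq_mul S hb,
      ← Finset.prod_mul_distrib]
    refine Finset.prod_congr rfl fun i hi => ?_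
    have hi' : IndepFun (f i) (g i) μ :=
      hfg.comp (measurable_pi_apply i) (measurable_pi_apply i)
    rw [hu' i hi, hi'.measure_inter_preimage_eq_mul _ _ (ha i hi) (hb i hi)]

/-- A random variable whose lower and upper tails agree has the same law as its negative. -/
theorem map_eq_map_neg [IsProbabilityMeasure μ] {Z : Ω → ℝ} (hZ : Measurable Z)
    (h : ∀ x : ℝ, 0 ≤ x → μ {ω | Z ω ≤ -x} = μ {ω | x ≤ Z ω}) :
    μ.map Z = μ.map fun ω => -Z ω := by
  have := Measure.isProbabilityMeasure_map (μ := μ) hZ.aemeasurable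
  have := Measure.isProbabilityMeasure_map (μ := μ) hZ.fun_neg.aemeasurable
  refine Measure.ext_of_Iic _ _ fun a => ?_
  rw [Measure.map_apply hZ measurableSet_Iic, Measure.map_apply hZ.fun_neg measurableSet_Iic]
  rcases le_or_gt a 0 with ha | ha
  · have := h (-a) (by linarith)
    rw [neg_neg] at this
    refine this.trans (congrArg μ ?_)
    ext ω
    simp only [Set.mem_ofPred_eq, Set.mem_preimage, Set.mem_Iic]
    constructor <;> intro h <;> linarith
  · -- strict tails are increasing limits of weak tails
    have hstrict : μ {ω | Z ω < -a} = μ {ω | a < Z ω} := by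
      have e1 : {ω | Z ω < -a} = ⋃ n : ℕ, {ω | Z ω ≤ -(a + 1 / ((n : ℝ) + 1))} := by
        ext ω
        simp only [Set.mem_ofPred_eq, Set.mem_iUnion]
        constructor
        · intro hlt
          obtain ⟨n, hn⟩ := exists_nat_one_div_lt (sub_pos.2 hlt)
          exact ⟨n, by linarith⟩
        · rintro ⟨n, hn⟩
          have : 0 < 1 / ((n : ℝ) + 1) := by positivity
          linarith
      have e2 : {ω | a < Z ω} = ⋃ n : ℕ, {ω | a + 1 / ((n : ℝ) + 1) ≤ Z ω} := by
        ext ω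
        simp only [Set.mem_ofPred_eq, Set.mem_iUnion]
        constructor
        · intro hlt
          obtain ⟨n, hn⟩ := exists_nat_one_div_lt (sub_pos.2 hlt)
          exact ⟨n, by linarith⟩
        · rintro ⟨n, hn⟩
          have : 0 < 1 / ((n : ℝ) + 1) := by positivity
          linarith
      rw [e1, e2, Monotone.measure_iUnion, Monotone.measure_iUnion]
      · exact iSup_congr fun n => h _ (by positivity)
      · intro m n hmn ω hω
        simp only [Set.mem_ofPred_eq] at hω ⊢
        linarith [Nat.one_div_le_one_div (α := ℝ) hmn]
      · intro m n hmn ω hω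
        simp only [Set.mem_ofPred_eq] at hω ⊢
        linarith [Nat.one_div_le_one_div (α := ℝ) hmn]
    have e1 : Z ⁻¹' Set.Iic a = {ω | a < Z ω}ᶜ := by ext ω; simp
    have e2 : (fun ω => -Z ω) ⁻¹' Set.Iic a = {ω | Z ω < -a}ᶜ := by
      ext ω
      simp only [Set.mem_preimage, Set.mem_Iic, Set.mem_compl_iff, Set.mem_ofPred_eq, not_lt]
      constructor <;> intro h <;> linarith
    rw [e1, e2, prob_compl_eq_one_sub (measurableSet_lt measurable_const hZ),
      prob_compl_eq_one_sub (measurableSet_lt hZ measurable_const), hstrict]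

/-- Thinning a symmetric random variable by an independent factor keeps it symmetric. -/
theorem map_mul_eq_map_neg_mul [IsProbabilityMeasure μ] {Z V : Ω → ℝ} (hZ : Measurable Z)
    (hV : Measurable V) (hZV : IndepFun V Z μ) (h : μ.map Z = μ.map fun ω => -Z ω) :
    μ.map (fun ω => Z ω * V ω) = μ.map fun ω => -(Z ω * V ω) := by
  have hn : IndepFun V (fun ω => -Z ω) μ := hZV.comp measurable_id measurable_neg
  have e : μ.map (fun ω => (V ω, Z ω)) = μ.map fun ω => (V ω, -Z ω) := by
    rw [(indepFun_iff_map_prod_eq_prod_map_map hV.aemeasurable hZ.aemeasurable).1 hZV,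
      (indepFun_iff_map_prod_eq_prod_map_map hV.aemeasurable hZ.fun_neg.aemeasurable).1 hn, h]
  have hm : Measurable fun q : ℝ × ℝ => q.2 * q.1 := by fun_prop
  have e' := congrArg (fun ν => Measure.map (fun q : ℝ × ℝ => q.2 * q.1) ν) e
  beta_reduce at e'
  rw [Measure.map_map hm (hV.prodMk hZ), Measure.map_map hm (hV.prodMk hZ.fun_neg)] at e'
  simpa [Function.comp_def] using e'

end Independence

/-! ### Averages of real sequences -/

section Averages

/-- A form of Kronecker's lemma, by dominated convergence for series. -/
theorem tendsto_average_zero {d : ℕ → ℝ} (hd : ∀ k, 0 ≤ d k)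
    (hsum : Summable fun k : ℕ => d k / ((k : ℝ) + 1)) :
    Tendsto (fun n : ℕ => (∑ k ∈ Finset.range n, d k) / n) atTop (𝓝 0) := by
  have hlim := tendsto_tsum_of_dominated_convergence (𝓕 := atTop)
    (f := fun (n k : ℕ) => if k < n then d k / (n : ℝ) else 0) (g := fun _ => (0 : ℝ)) hsum
    (fun k => by
      refine (tendsto_const_div_atTop_nhds_zero_nat (d k)).congr' ?_
      filter_upwards [eventually_gt_atTop k] with n hn
      rw [if_pos hn])
    (Eventually.of_forall fun n k => by
      split_ifs with h
      · rw [Real.norm_of_nonneg (div_nonneg (hd k) n.cast_nonneg)]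
        have : (k : ℝ) + 1 ≤ n := by exact_mod_cast h
        exact div_le_div_of_nonneg_left (hd k) (by positivity) this
      · rw [norm_zero]
        exact div_nonneg (hd k) (by positivity))
  rw [tsum_zero] at hlim
  refine hlim.congr fun n => ?_
  rw [tsum_eq_sum (s := Finset.range n) fun k hk => if_neg fun h => hk (Finset.mem_range.2 h),
    Finset.sum_div]
  exact Finset.sum_congr rfl fun k hk => if_pos (Finset.mem_range.1 hk)

theorem summable_of_summable_rpow {x : ℕ → ℝ} {a : ℝ} (ha : 0 < a) (ha1 : a ≤ 1)
    (hx : ∀ k, 0 ≤ x k) (h : Summable fun k => x k ^ a) : Summable x := by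
  refine Summable.of_norm_bounded_eventually_nat h ?_
  filter_upwards [h.tendsto_atTop_zero.eventually (gt_mem_nhds one_pos)] with k hk
  have h1 : x k ≤ 1 := by
    by_contra hcon
    exact absurd (Real.one_le_rpow (not_le.1 hcon).le ha.le) (not_le.2 hk)
  rw [Real.norm_of_nonneg (hx k)]
  rcases (hx k).eq_or_lt with h0 | h0
  · rw [← h0]; exact Real.rpow_nonneg le_rfl _
  · simpa using Real.rpow_le_rpow_of_exponent_ge h0 h1 ha1

end Averages

/-! ### Tails and moments -/

section Tails

variable {Ω : Type*} {mΩ : MeasurableSpace Ω} {μ : Measure Ω}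

theorem eventually_tail_bounds {Z : Ω → ℝ} {α c : ℝ} (hc : 0 < c)
    (htail : (fun r : ℝ => μ.real {ω | r < Z ω}) ~[atTop] fun r : ℝ => c * r ^ (-α)) :
    ∀ᶠ r : ℝ in atTop, c / 2 * r ^ (-α) ≤ μ.real {ω | r < Z ω} ∧
      μ.real {ω | r < Z ω} ≤ 2 * c * r ^ (-α) := by
  filter_upwards [htail.isLittleO.bound (show (0 : ℝ) < 1 / 2 by norm_num),
    eventually_ge_atTop 0] with r hr hr0
  have hpos : 0 ≤ c * r ^ (-α) := mul_nonneg hc.le (Real.rpow_nonneg hr0 _)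
  rw [Pi.sub_apply, Real.norm_of_nonneg hpos, Real.norm_eq_abs, abs_le] at hr
  constructor <;> linarith [hr.1, hr.2]

/-- A nonnegative random variable with a tail of order `r ^ (-α)` has moments of every order
`a < α`. -/
theorem lintegral_rpow_lt_top_of_tail [IsProbabilityMeasure μ] {Z : Ω → ℝ} (hZ : Measurable Z)
    (hZ0 : ∀ ω, 0 ≤ Z ω) {α a C : ℝ} (ha : 0 < a) (haα : a < α)
    (htail : ∀ᶠ r : ℝ in atTop, μ.real {ω | r < Z ω} ≤ C * r ^ (-α)) :
    ∫⁻ ω, ENNReal.ofReal (Z ω ^ a) ∂μ < ∞ := by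
  obtain ⟨R, hR, hR0⟩ : ∃ R : ℝ, (∀ r, R ≤ r → μ.real {ω | r < Z ω} ≤ C * r ^ (-α)) ∧ 0 < R := by
    obtain ⟨R, hR⟩ := (htail.and (eventually_gt_atTop 0)).exists_forall_of_atTop
    exact ⟨R, fun r hr => (hR r hr).1, (hR R le_rfl).2⟩
  rw [lintegral_rpow_eq_lintegral_meas_lt_mul μ (Eventually.of_forall hZ0) hZ.aemeasurable ha]
  refine ENNReal.mul_lt_top ENNReal.ofReal_lt_top ?_
  rw [← Set.Ioc_union_Ioi_eq_Ioi hR0.le]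
  refine (lintegral_union_le _ _ _).trans_lt (ENNReal.add_lt_top.2 ⟨?_, ?_⟩)
  · have hint : IntegrableOn (fun t : ℝ => t ^ (a - 1)) (Set.Ioc 0 R) :=
      (intervalIntegrable_iff_integrableOn_Ioc_of_le hR0.le).1
        (intervalIntegral.intervalIntegrable_rpow' (by linarith))
    refine (lintegral_mono fun t => ?_).trans_lt hint.lintegral_lt_top
    exact mul_le_of_le_one_left' prob_le_one
  · have hint : IntegrableOn (fun t : ℝ => C * t ^ (a - 1 - α)) (Set.Ioi R) :=
      (integrableOn_Ioi_rpow_of_lt (by linarith) hR0).const_mul C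
    refine (setLIntegral_mono_ae (by fun_prop)
      (Eventually.of_forall fun t ht => ?_)).trans_lt hint.lintegral_lt_top
    have ht0 : 0 < t := hR0.trans ht
    rw [← ofReal_measureReal, ← ENNReal.ofReal_mul measureReal_nonneg]
    refine ENNReal.ofReal_le_ofReal ?_
    rw [show a - 1 - α = -α + (a - 1) by ring, Real.rpow_add ht0, ← mul_assoc]
    exact mul_le_mul_of_nonneg_right (hR t (le_of_lt ht)) (Real.rpow_nonneg ht0.le _)

end Tails

/-! ### Thinned heavy-tailed variables -/

section Thinning

variable {Ω : Type*} {mΩ : MeasurableSpace Ω} {μ : Measure Ω} [IsProbabilityMeasure μ]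

/-- If the `k`-th copy of a heavy-tailed variable is retained with probability `(k + 1) ^ (-β)` and
`α + β ≤ 1`, infinitely many of the retained variables exceed a given linear function, by the second
Borel–Cantelli lemma. -/
theorem ae_frequently_lt_thinned {Z V : ℕ → Ω → ℝ} {Z₀ : Ω → ℝ} {α β c L : ℝ}
    (hZ : ∀ k, Measurable (Z k)) (hV : ∀ k, Measurable (V k))
    (hindep : iIndepFun (fun k ω => Z k ω * V k ω) μ) (hVZ : ∀ k, IndepFun (V k) (Z k) μ)
    (hident : ∀ k, IdentDistrib (Z k) Z₀ μ μ)
    (hVp : ∀ k : ℕ, μ.real {ω | V k ω = 1} = ((k : ℝ) + 1) ^ (-β))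
    (hc : 0 < c) (hL : 0 < L) (hαβ : α + β ≤ 1)
    (htail : ∀ᶠ r : ℝ in atTop, c * r ^ (-α) ≤ μ.real {ω | r < Z₀ ω}) :
    ∀ᵐ ω ∂μ, ∃ᶠ k : ℕ in atTop, L * k < Z k ω * V k ω := by
  have hY : ∀ k, Measurable fun ω => Z k ω * V k ω := fun k => (hZ k).mul (hV k)
  set A : ℕ → Set Ω := fun k => {ω | L * k < Z k ω * V k ω} with hA
  have hAm : ∀ k, MeasurableSet (A k) := fun k => measurableSet_lt measurable_const (hY k)
  have hAi : iIndepSet A μ := by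
    rw [iIndepSet_iff_meas_biInter hAm]
    intro s
    exact hindep.meas_biInter fun k _ => ⟨Set.Ioi (L * k), measurableSet_Ioi, rfl⟩
  have hlow : ∀ᶠ k : ℕ in atTop,
      c * L ^ (-α) * (((k + 1 : ℕ) : ℝ) ^ (-(α + β))) ≤ μ.real (A k) := by
    have hlin : Tendsto (fun k : ℕ => L * ((k : ℝ) + 1)) atTop atTop :=
      (tendsto_atTop_add_const_right _ 1 tendsto_natCast_atTop_atTop).const_mul_atTop hL
    filter_upwards [hlin.eventually htail] with k hk
    have hk0 : (0 : ℝ) < (k : ℝ) + 1 := by positivity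
    have hsub : V k ⁻¹' {1} ∩ Z k ⁻¹' Set.Ioi (L * ((k : ℝ) + 1)) ⊆ A k := by
      rintro ω ⟨h1, h2⟩
      have h1' : V k ω = 1 := h1
      have h2' : L * ((k : ℝ) + 1) < Z k ω := h2
      change L * k < Z k ω * V k ω
      rw [h1', mul_one]
      linarith
    have hprob : μ.real (V k ⁻¹' {1} ∩ Z k ⁻¹' Set.Ioi (L * ((k : ℝ) + 1))) =
        ((k : ℝ) + 1) ^ (-β) * μ.real {ω | L * ((k : ℝ) + 1) < Z₀ ω} := by
      rw [measureReal_def, (hVZ k).measure_inter_preimage_eq_mul _ _ (measurableSet_singleton 1)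
        measurableSet_Ioi, ENNReal.toReal_mul, (hident k).measure_mem_eq measurableSet_Ioi, ← hVp k]
      rfl
    refine le_trans ?_ (measureReal_mono hsub)
    rw [hprob]
    refine le_trans (le_of_eq ?_) (mul_le_mul_of_nonneg_left hk (Real.rpow_nonneg hk0.le _))
    push_cast
    rw [Real.mul_rpow hL.le hk0.le, show -(α + β) = -β + -α by ring, Real.rpow_add hk0]
    ring
  have htop : ∑' k, μ (A k) = ∞ := by
    by_contra hne
    have hs : Summable fun k => μ.real (A k) := ENNReal.summable_toReal hne
    have hs2 : Summable fun k : ℕ => c * L ^ (-α) * (((k + 1 : ℕ) : ℝ) ^ (-(α + β))) := by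
      refine Summable.of_norm_bounded_eventually_nat hs ?_
      filter_upwards [hlow] with k hk
      rwa [Real.norm_of_nonneg (by positivity)]
    have hs3 := (summable_mul_left_iff (mul_pos hc (Real.rpow_pos_of_pos hL (-α))).ne').1 hs2
    have hs4 := (summable_nat_add_iff (f := fun n : ℕ => (n : ℝ) ^ (-(α + β))) 1).1 hs3
    linarith [Real.summable_nat_rpow.1 hs4]
  have hone := measure_limsup_eq_one hAm hAi htop
  have hm : MeasurableSet (limsup A atTop) := MeasurableSet.measurableSet_limsup hAm
  filter_upwards [(mem_ae_iff_prob_eq_one hm).2 hone] with ω hω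
  exact mem_limsup_iff_frequently_mem.1 hω

/-- If the `k`-th copy of a variable with a finite moment of order `a ≤ 1` is retained with
probability `(k + 1) ^ (-β)` and `a + β > 1`, the averages of the retained variables tend to `0`. -/
theorem ae_tendsto_average_thinned {Z V : ℕ → Ω → ℝ} {Z₀ : Ω → ℝ} {a β : ℝ}
    (hZ : ∀ k, Measurable (Z k)) (hV : ∀ k, Measurable (V k)) (hZ0 : ∀ k ω, 0 ≤ Z k ω)
    (hVZ : ∀ k, IndepFun (V k) (Z k) μ) (hident : ∀ k, IdentDistrib (Z k) Z₀ μ μ)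
    (hV01 : ∀ k ω, V k ω = 0 ∨ V k ω = 1)
    (hVp : ∀ k : ℕ, μ.real {ω | V k ω = 1} = ((k : ℝ) + 1) ^ (-β))
    (ha : 0 < a) (ha1 : a ≤ 1) (haβ : 1 < a + β)
    (hmom : ∫⁻ ω, ENNReal.ofReal (Z₀ ω ^ a) ∂μ < ∞) :
    ∀ᵐ ω ∂μ, Tendsto (fun n : ℕ => (∑ k ∈ Finset.range n, Z k ω * V k ω) / n) atTop (𝓝 0) := by
  have hV0 : ∀ k ω, 0 ≤ V k ω := fun k ω => by rcases hV01 k ω with h | h <;> simp [h]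
  have hq : ∀ k ω, 0 ≤ Z k ω * V k ω / ((k : ℝ) + 1) := fun k ω =>
    div_nonneg (mul_nonneg (hZ0 k ω) (hV0 k ω)) (by positivity)
  have hterm : ∀ k ω, ENNReal.ofReal ((Z k ω * V k ω / ((k : ℝ) + 1)) ^ a) =
      ENNReal.ofReal (((k : ℝ) + 1) ^ (-a)) *
        (ENNReal.ofReal (V k ω) * ENNReal.ofReal (Z k ω ^ a)) := by
    intro k ω
    rw [← ENNReal.ofReal_mul (hV0 k ω), ← ENNReal.ofReal_mul (by positivity)]
    congr 1
    have hk : (0 : ℝ) ≤ (k : ℝ) + 1 := by positivity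
    rw [Real.div_rpow (mul_nonneg (hZ0 k ω) (hV0 k ω)) hk, Real.rpow_neg hk]
    rcases hV01 k ω with h | h
    · simp [h, Real.zero_rpow ha.ne']
    · simp only [h, mul_one, one_mul]
      rw [div_eq_mul_inv, mul_comm]
  have hVint : ∀ k : ℕ, ∫⁻ ω, ENNReal.ofReal (V k ω) ∂μ =
      ENNReal.ofReal (((k : ℝ) + 1) ^ (-β)) := by
    intro k
    have hind : (fun ω => ENNReal.ofReal (V k ω)) = {ω | V k ω = 1}.indicator 1 := by
      ext ω
      rcases hV01 k ω with h | h <;> simp [h]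
    have hm : MeasurableSet {ω | V k ω = 1} := hV k (measurableSet_singleton 1)
    rw [hind, lintegral_indicator_one hm, ← hVp k, ofReal_measureReal]
  have hpow : Measurable fun z : ℝ => ENNReal.ofReal (z ^ a) := by fun_prop
  have hint : ∀ k : ℕ, ∫⁻ ω, ENNReal.ofReal ((Z k ω * V k ω / ((k : ℝ) + 1)) ^ a) ∂μ =
      ENNReal.ofReal (((k + 1 : ℕ) : ℝ) ^ (-(a + β))) *
        ∫⁻ ω, ENNReal.ofReal (Z₀ ω ^ a) ∂μ := by
    intro k
    have hm1 : Measurable fun ω => ENNReal.ofReal (V k ω) := (hV k).ennreal_ofReal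
    have hm2 : Measurable fun ω => ENNReal.ofReal (Z k ω ^ a) := hpow.comp (hZ k)
    have hi : IndepFun (fun ω => ENNReal.ofReal (V k ω)) (fun ω => ENNReal.ofReal (Z k ω ^ a)) μ :=
      (hVZ k).comp ENNReal.measurable_ofReal hpow
    have hk : (0 : ℝ) < (k : ℝ) + 1 := by positivity
    have hZa : ∫⁻ ω, ENNReal.ofReal (Z k ω ^ a) ∂μ = ∫⁻ ω, ENNReal.ofReal (Z₀ ω ^ a) ∂μ :=
      ((hident k).comp hpow).lintegral_eq
    simp_rw [hterm]
    rw [lintegral_const_mul _ (hm1.fun_mul hm2),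
      lintegral_mul_eq_lintegral_mul_lintegral_of_indepFun'' hm1.aemeasurable hm2.aemeasurable hi,
      hVint, hZa, ← mul_assoc,
      ← ENNReal.ofReal_mul (Real.rpow_nonneg hk.le _), ← Real.rpow_add hk]
    push_cast
    rw [neg_add]
  have hmeas : ∀ k : ℕ,
      Measurable fun ω => ENNReal.ofReal ((Z k ω * V k ω / ((k : ℝ) + 1)) ^ a) := fun k =>
    hpow.comp (((hZ k).mul (hV k)).div_const _)
  have hfin : ∫⁻ ω, ∑' k : ℕ, ENNReal.ofReal ((Z k ω * V k ω / ((k : ℝ) + 1)) ^ a) ∂μ ≠ ∞ := by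
    rw [lintegral_tsum fun k => (hmeas k).aemeasurable]
    simp_rw [hint]
    rw [ENNReal.tsum_mul_right]
    refine ENNReal.mul_ne_top ?_ hmom.ne
    have hs : Summable fun k : ℕ => ((k + 1 : ℕ) : ℝ) ^ (-(a + β)) :=
      (summable_nat_add_iff (f := fun n : ℕ => (n : ℝ) ^ (-(a + β))) 1).2
        (Real.summable_nat_rpow.2 (by linarith))
    exact hs.tsum_ofReal_ne_top
  filter_upwards [ae_lt_top (Measurable.tsum hmeas) hfin] with ω hω
  refine tendsto_average_zero (fun k => mul_nonneg (hZ0 k ω) (hV0 k ω))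
    (summable_of_summable_rpow ha ha1 (hq · ω) ?_)
  have := ENNReal.summable_toReal hω.ne
  refine this.congr fun k => ?_
  rw [ENNReal.toReal_ofReal (Real.rpow_nonneg (hq k ω) _)]

end Thinning

/-! ### Criteria in terms of the log-odds -/

section LogOdds

theorem weight_eq_exp (p : Environment) {u : ℕ → ℝ}
    (hu : ∀ k, (p (k + 1) : ℝ) / (1 - (p (k + 1) : ℝ)) = Real.exp (u k)) (n : ℕ) :
    weight p n = Real.exp (∑ k ∈ Finset.range n, u k) := by
  rw [weight, Real.exp_sum]
  exact Finset.prod_congr rfl fun k _ => hu k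

/-- Environments in which the average log-odds tend to a positive limit are recurrent. -/
theorem walkRecurrent_of_tendsto_average (p : Environment) {u : ℕ → ℝ} {v : ℝ} (hv : 0 < v)
    (hu : ∀ k, (p (k + 1) : ℝ) / (1 - (p (k + 1) : ℝ)) = Real.exp (u k))
    (h : Tendsto (fun n : ℕ => (∑ k ∈ Finset.range n, u k) / n) atTop (𝓝 v)) :
    WalkRecurrent p := by
  refine walkRecurrent_of_frequently p (Eventually.frequently ?_)
  filter_upwards [h.eventually (lt_mem_nhds hv), eventually_gt_atTop 0] with n hn hn0
  rw [weight_eq_exp p hu]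
  have hn' : (0 : ℝ) < n := by exact_mod_cast hn0
  exact Real.one_le_exp ((div_pos_iff_of_pos_right hn').1 hn).le

/-- Environments in which the average log-odds tend to a negative limit are transient. -/
theorem walkTransient_of_tendsto_average (p : Environment) {u : ℕ → ℝ} {v : ℝ} (hv : v < 0)
    (hu : ∀ k, (p (k + 1) : ℝ) / (1 - (p (k + 1) : ℝ)) = Real.exp (u k))
    (h : Tendsto (fun n : ℕ => (∑ k ∈ Finset.range n, u k) / n) atTop (𝓝 v)) :
    WalkTransient p := by
  refine walkTransient_of_summable p
    (Summable.of_norm_bounded_eventually_nat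
      (Real.summable_exp_nat_mul_iff.2 (show v / 2 < 0 by linarith)) ?_)
  filter_upwards [h.eventually (gt_mem_nhds (show v < v / 2 by linarith)),
    eventually_gt_atTop 0] with n hn hn0
  rw [Real.norm_of_nonneg (weight_pos p n).le, weight_eq_exp p hu, Real.exp_le_exp]
  have hn' : (0 : ℝ) < n := by exact_mod_cast hn0
  rw [div_lt_iff₀ hn'] at hn
  linarith

end LogOdds

end BirthDeath

theorem theorem6
    {Ω : Type*} [MeasurableSpace Ω] (μ : Measure Ω) [IsProbabilityMeasure μ]
    (δ α β c : ℝ) (φ : ℕ → ℝ) (χ ξ ζ : ℕ → Ω → ℝ) (p : ℕ → Ω → Set.Ioo (0 : ℝ) 1)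
    (hδ : δ ∈ Set.Ioo (-1 : ℝ) 1)
    -- independent `{0,1}`-valued `χ n` with `P[χ n = 1] = φ n`, where `φ : ℕ → [0,1]`
    (hφ : ∀ n, φ n ∈ Set.Icc (0 : ℝ) 1)
    (hχ_meas : ∀ n, Measurable (χ n))
    (hχ_val : ∀ n ω, χ n ω = 0 ∨ χ n ω = 1)
    (hχ_prob : ∀ n, μ.real {ω | χ n ω = 1} = φ n)
    (hχ_indep : iIndepFun χ μ)
    -- i.i.d. `(0,1)`-valued `ξ n`, independent of the `χ n`
    (hξ_meas : ∀ n, Measurable (ξ n))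
    (hξ_val : ∀ n ω, ξ n ω ∈ Set.Ioo (0 : ℝ) 1)
    (hξ_indep : iIndepFun ξ μ)
    (hξ_ident : ∀ n, IdentDistrib (ξ n) (ξ 0) μ μ)
    (hχξ : IndepFun (fun ω n => χ n ω) (fun ω n => ξ n ω) μ)
    -- the environment, and the log-odds of its random part
    (hp : ∀ n ω, (p n ω : ℝ) = (1 - δ) / 2 * χ n ω + ξ n ω * (1 - χ n ω))
    (hζ : ∀ n ω, ζ n ω = Real.log (ξ n ω / (1 - ξ n ω)))
    -- symmetry and tail of `ζ 0`
    (hsymm : ∀ x : ℝ, 0 ≤ x → μ {ω | ζ 0 ω ≤ -x} = μ {ω | x ≤ ζ 0 ω})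
    (hα : α ∈ Set.Ioo (0 : ℝ) 1) (hc : 0 < c)
    (htail : (fun r : ℝ => μ.real {ω | r < ζ 0 ω}) ~[atTop] fun r : ℝ => c * r ^ (-α))
    -- mostly fast points
    (hβ : β ∈ Set.Ioo (0 : ℝ) 1)
    (hφ_eq : ∀ n : ℕ, 1 ≤ n → φ n = 1 - (n : ℝ) ^ (-β)) :
    (β < 1 - α → ∀ᵐ ω ∂μ, WalkRecurrent (fun n => p n ω)) ∧
    (1 - α < β →
      (δ < 0 → ∀ᵐ ω ∂μ, WalkRecurrent (fun n => p n ω)) ∧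
      (0 < δ → ∀ᵐ ω ∂μ, WalkTransient (fun n => p n ω))) := by
  have hδ1 : 0 < 1 - δ := sub_pos.2 hδ.2
  have hδ2 : 0 < 1 + δ := by linarith [hδ.1]
  set v : ℝ := Real.log ((1 - δ) / (1 + δ)) with hv
  -- `V k` marks the sites `k + 1` whose jump probability is drawn at random
  set V : ℕ → Ω → ℝ := fun k ω => 1 - χ (k + 1) ω with hV
  have hV01 : ∀ k ω, V k ω = 0 ∨ V k ω = 1 := fun k ω => by
    rcases hχ_val (k + 1) ω with h | h <;> simp [hV, h]
  have hVm : ∀ k, Measurable (V k) := fun k => measurable_const.sub (hχ_meas (k + 1))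
  have hVp : ∀ k : ℕ, μ.real {ω | V k ω = 1} = ((k : ℝ) + 1) ^ (-β) := fun k => by
    have hset : {ω | V k ω = 1} = {ω | χ (k + 1) ω = 1}ᶜ := by
      ext ω
      rcases hχ_val (k + 1) ω with h | h <;> simp [hV, h]
    have hm : MeasurableSet {ω | χ (k + 1) ω = 1} := hχ_meas (k + 1) (measurableSet_singleton 1)
    rw [hset, probReal_compl_eq_one_sub hm, hχ_prob, hφ_eq _ (Nat.le_add_left 1 k)]
    push_cast
    ring
  -- the log-odds function
  set ℓ : ℝ → ℝ := fun x => Real.log (x / (1 - x)) with hℓ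
  have hℓm : Measurable ℓ := by fun_prop
  have hζ_eq : ∀ n, ζ n = ℓ ∘ ξ n := fun n => funext (hζ n)
  have hζm : ∀ n, Measurable (ζ n) := fun n => hζ_eq n ▸ hℓm.comp (hξ_meas n)
  have hζid : ∀ n, IdentDistrib (ζ n) (ζ 0) μ μ := fun n => by
    rw [hζ_eq, hζ_eq]
    exact (hξ_ident n).comp hℓm
  have hpair : iIndepFun (fun n ω => (χ n ω, ξ n ω)) μ :=
    BirthDeath.iIndepFun_prodMk_of_indepFun hχ_meas hξ_meas hχ_indep hξ_indep hχξ
  have hVζ : ∀ k, IndepFun (V k) (ζ (k + 1)) μ := fun k => by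
    rw [hζ_eq]
    exact hχξ.comp (φ := fun y : ℕ → ℝ => 1 - y (k + 1)) (ψ := fun y : ℕ → ℝ => ℓ (y (k + 1)))
      (by fun_prop) (hℓm.comp (measurable_pi_apply _))
  have hu : ∀ ω k, (p (k + 1) ω : ℝ) / (1 - (p (k + 1) ω : ℝ)) =
      Real.exp ((ζ (k + 1) ω - v) * V k ω + v) := by
    intro ω k
    rcases hχ_val (k + 1) ω with h | h
    · have h1 := (hξ_val (k + 1) ω).1
      have h2 := sub_pos.2 (hξ_val (k + 1) ω).2
      simp only [hp, hV, h, hζ]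
      rw [mul_zero, zero_add, sub_zero, mul_one, mul_one, sub_add_cancel,
        Real.exp_log (div_pos h1 h2)]
    · simp only [hp, hV, h]
      rw [sub_self, mul_zero, mul_zero, add_zero, zero_add, mul_one, hv,
        Real.exp_log (div_pos hδ1 hδ2), show 1 - (1 - δ) / 2 = (1 + δ) / 2 by ring,
        div_div_div_cancel_right₀ two_ne_zero]
  have hbounds := BirthDeath.eventually_tail_bounds hc htail
  have hlaw : μ.map (ζ 0) = μ.map fun ω => -ζ 0 ω := BirthDeath.map_eq_map_neg (hζm 0) hsymm
  refine ⟨fun hlt => ?_, fun hgt => ?_⟩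
  · have hYm : ∀ k, Measurable fun ω => ζ (k + 1) ω * V k ω := fun k => (hζm (k + 1)).mul (hVm k)
    have hYi : iIndepFun (fun k ω => ζ (k + 1) ω * V k ω) μ := by
      have h1 : iIndepFun (fun k ω => (χ (k + 1) ω, ξ (k + 1) ω)) μ :=
        hpair.precomp (g := fun k : ℕ => k + 1) (add_left_injective 1)
      have h2 := h1.comp (fun _ q => ℓ q.2 * (1 - q.1)) fun _ =>
        (hℓm.comp measurable_snd).mul (measurable_const.sub measurable_fst)
      simp only [hζ_eq]
      exact h2
    have hYs : ∀ k, μ.map (fun ω => ζ (k + 1) ω * V k ω) =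
        μ.map fun ω => -(ζ (k + 1) ω * V k ω) := fun k => by
      refine BirthDeath.map_mul_eq_map_neg_mul (hζm (k + 1)) (hVm k) (hVζ k) ?_
      rw [(hζid (k + 1)).map_eq, hlaw]
      exact ((hζid (k + 1)).comp measurable_neg).map_eq.symm
    have hbig := BirthDeath.ae_frequently_lt_thinned (L := 2 * |v| + 1) (fun k => hζm (k + 1)) hVm
      hYi hVζ (fun k => hζid (k + 1)) hVp (half_pos hc) (by positivity) (by linarith)
      (hbounds.mono fun r hr => hr.1)
    filter_upwards [BirthDeath.ae_frequently_mul_le_sum hYm hYi hYs |v| hbig] with ω hω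
    refine BirthDeath.walkRecurrent_of_frequently _ (hω.mono fun n hn => ?_)
    rw [BirthDeath.weight_eq_exp (fun n => p n ω) (hu ω)]
    refine Real.one_le_exp ?_
    have hle : ∑ k ∈ Finset.range n, (ζ (k + 1) ω * V k ω - |v|) ≤
        ∑ k ∈ Finset.range n, ((ζ (k + 1) ω - v) * V k ω + v) := by
      refine Finset.sum_le_sum fun k _ => ?_
      rcases hV01 k ω with h | h <;> rw [h]
      · linarith [neg_abs_le v]
      · linarith [abs_nonneg v]
    rw [Finset.sum_sub_distrib, Finset.sum_const, Finset.card_range, nsmul_eq_mul] at hle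
    linarith
  · -- a moment order below `α` for which the thinned moments are still summable
    set a : ℝ := (1 - β + α) / 2 with ha
    have ha0 : 0 < a := by linarith [hβ.2, hα.1]
    have haα : a < α := by linarith
    have ha1 : a ≤ 1 := haα.le.trans hα.2.le
    have haβ : 1 < a + β := by linarith
    have habs : ∀ᶠ r : ℝ in atTop, μ.real {ω | r < |ζ 0 ω|} ≤ (4 * c) * r ^ (-α) := by
      filter_upwards [hbounds] with r hr
      have hneg : μ.real {ω | r < -ζ 0 ω} = μ.real {ω | r < ζ 0 ω} := by
        have h1 := Measure.map_apply (μ := μ) (hζm 0) (measurableSet_Ioi (a := r))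
        have h2 := Measure.map_apply (μ := μ) (hζm 0).fun_neg (measurableSet_Ioi (a := r))
        rw [← hlaw, h1] at h2
        exact congrArg ENNReal.toReal h2.symm
      have hsub : {ω | r < |ζ 0 ω|} ⊆ {ω | r < ζ 0 ω} ∪ {ω | r < -ζ 0 ω} := by
        intro ω hω
        have h : r < |ζ 0 ω| := hω
        exact (lt_abs.1 h).imp id id
      have := (measureReal_mono (μ := μ) hsub).trans (measureReal_union_le _ _)
      rw [hneg] at this
      linarith [hr.2]
    have hmom0 := BirthDeath.lintegral_rpow_lt_top_of_tail (hζm 0).abs (fun ω => abs_nonneg _) ha0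
      haα habs
    have hmom : ∫⁻ ω, ENNReal.ofReal ((|v| + |ζ 0 ω|) ^ a) ∂μ < ⊤ := by
      have hle : ∀ ω, ENNReal.ofReal ((|v| + |ζ 0 ω|) ^ a) ≤
          ENNReal.ofReal (|v| ^ a) + ENNReal.ofReal (|ζ 0 ω| ^ a) := fun ω =>
        (ENNReal.ofReal_le_ofReal (Real.rpow_add_le_add_rpow (abs_nonneg _) (abs_nonneg _)
          ha0.le ha1)).trans ENNReal.ofReal_add_le
      refine (lintegral_mono hle).trans_lt ?_
      rw [lintegral_add_left measurable_const, lintegral_const, measure_univ, mul_one]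
      exact ENNReal.add_lt_top.2 ⟨ENNReal.ofReal_lt_top, hmom0⟩
    have hshift : Measurable fun z : ℝ => |v| + |z| := by fun_prop
    have havg := BirthDeath.ae_tendsto_average_thinned (Z := fun k ω => |v| + |ζ (k + 1) ω|)
      (fun k => hshift.comp (hζm (k + 1))) hVm (fun k ω => by positivity)
      (fun k => (hVζ k).comp measurable_id hshift) (fun k => (hζid (k + 1)).comp hshift) hV01 hVp
      ha0 ha1 haβ hmom
    -- the averages of the log-odds tend to those of the fast sites
    have hlim : ∀ᵐ ω ∂μ, Tendsto
        (fun n : ℕ => (∑ k ∈ Finset.range n, ((ζ (k + 1) ω - v) * V k ω + v)) / n) atTop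
        (nhds v) := by
      filter_upwards [havg] with ω hω
      have hzero : Tendsto (fun n : ℕ => (∑ k ∈ Finset.range n, (ζ (k + 1) ω - v) * V k ω) / n)
          atTop (nhds 0) := by
        refine squeeze_zero_norm (fun n => ?_) hω
        rw [norm_div, Real.norm_natCast]
        refine div_le_div_of_nonneg_right ((norm_sum_le _ _).trans
          (Finset.sum_le_sum fun k _ => ?_)) n.cast_nonneg
        have hV0 : 0 ≤ V k ω := by rcases hV01 k ω with h | h <;> simp [h]
        rw [norm_mul, Real.norm_of_nonneg hV0, Real.norm_eq_abs]
        refine mul_le_mul_of_nonneg_right ?_ hV0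
        exact (abs_sub _ _).trans (add_comm _ _).le
      have := hzero.add_const v
      rw [zero_add] at this
      refine this.congr' ?_
      filter_upwards [eventually_gt_atTop 0] with n hn
      have hn' : (n : ℝ) ≠ 0 := by exact_mod_cast hn.ne'
      rw [Finset.sum_add_distrib, Finset.sum_const, Finset.card_range, nsmul_eq_mul, add_div,
        mul_div_cancel_left₀ _ hn']
    refine ⟨fun hneg => ?_, fun hpos => ?_⟩
    · have hv0 : 0 < v := Real.log_pos ((one_lt_div hδ2).2 (by linarith))
      filter_upwards [hlim] with ω hω
      exact BirthDeath.walkRecurrent_of_tendsto_average _ hv0 (hu ω) hω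
    · have hv0 : v < 0 := Real.log_neg (div_pos hδ1 hδ2) ((div_lt_one hδ2).2 (by linarith))
      filter_upwards [hlim] with ω hω
      exact BirthDeath.walkTransient_of_tendsto_average _ hv0 (hu ω) hω
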